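/- Let $G$ be a Lie group with Lie algebra $\mathfrak g=T_eG$ and let $\tau:P\to M$ be a smooth principal $G$-bundle with right action $R_g(p)=p\cdot g$. For $p\in P$ let $V_pP=\ker T_p\tau$ be the vertical space, identified with $\mathfrak g$ through the isomorphism $\mathfrak g\to V_pP$, $\xi\mapsto \frac{d}{dt}\big|_{t=0}\,p\cdot\exp(t\xi)$. Let $$J^1P=\bigcup_{p\in P}\{\rho:T_{\tau(p)}M\to T_pP \text{ linear} \;:\; T_p\tau\circ\rho=\mathrm{id}\}$$ be the first jet bundle, with its standard smooth structure, with projection $\tau_{10}:J^1P\to P$ sending $\rho$ to its base point $p$, and with the right $G$-action $\rho\cdot g=T_pR_g\circ\rho$. The canonical form $\omega\in\Omega^1(J^1P,\mathfrak g)$ is given by $$\omega|_\rho(Y)=(\mathrm{id}-\rho\circ T_p\tau)\bigl(T_\rho\tau_{10}(Y)\bigr)\in V_pP\simeq\mathfrak g,\qquad p=\tau_{10}(\rho),\ Y\in T_\rho J^1P .$$ Let $C(P)=J^1P/G$ be the bundle of connections, with projection $\pi:C(P)\to M$, $\pi([\rho]_G)=\tau(\tau_{10}(\rho))$, and identify $J^1P$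 with the pullback $\pi^*P=\{(c,u)\in C(P)\times P:\pi(c)=\tau(u)\}$ through the bijection $\rho\mapsto([\rho]_G,\tau_{10}(\rho))$. Let $\Gamma$ be a connection on $P$, that is, a smooth family of linear projections $\Gamma_p:T_pP\to V_pP$ onto the vertical spaces with $\Gamma_{p\cdot g}\circ T_pR_g=T_pR_g\circ\Gamma_p$ for all $p\in P$, $g\in G$. Let $\omega_\Gamma\in\Omega^1(P,\mathfrak g)$ be its connection form, $\omega_\Gamma|_p(X)=\Gamma_p(X)\in V_pP\simeq\mathfrak g$. Let $\sigma_\Gamma:M\to C(P)$ be the section with $\sigma_\Gamma(m)=[\rho]_G$, where $\rho$ is a jet at some $p\in\tau^{-1}(m)$ with $\mathrm{id}-\rho\circ T_p\tau=\Gamma_p$, and let $\tilde\sigma_\Gamma:P\to J^1P\simeq\pi^*P$ be the map $\tilde\sigma_\Gamma(u)=(\sigma_\Gamma(\tau(u)),u)$. Then $\tilde\sigma_\Gamma$ is a smooth section of $\tau_{10}:J^1P\to P$, and $$\tilde\sigma_\Gamma^*\,\omega=\omega_\Gamma .$$ -/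

import Mathlib

open Bundle Set Filter
open scoped Manifold ContDiff Topology Bundle

noncomputable section


section TangentCongr

variable {E H X : Type*} [NormedAddCommGroup E] [NormedSpace ℝ E] [TopologicalSpace H]
  (I : ModelWithCorners ℝ E H) [TopologicalSpace X] [ChartedSpace H X]

/-- The identification of the tangent spaces at two equal points. -/
def tangentCongr {x y : X} (h : x = y) : TangentSpace I x ≃L[ℝ] TangentSpace I y :=
  h ▸ ContinuousLinearEquiv.refl ℝ (TangentSpace I x)

theorem tangentCongr_rfl {x : X} (v : TangentSpace I x) : tangentCongr I (rfl : x = x) v = v := rfl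

theorem tangentCongr_trans {x y z : X} (h : x = y) (h' : y = z) (v : TangentSpace I x) :
    tangentCongr I h' (tangentCongr I h v) = tangentCongr I (h.trans h') v := by
  subst h; subst h'; rfl

theorem tangentCongr_eq {x y : X} (h : x = y) (v : TangentSpace I x) :
    (tangentCongr I h v : E) = (v : E) := by
  subst h; rfl

variable {I}
variable {E' H' Y : Type*} [NormedAddCommGroup E'] [NormedSpace ℝ E'] [TopologicalSpace H']
  {J : ModelWithCorners ℝ E' H'} [TopologicalSpace Y] [ChartedSpace H' Y]
  {E'' H'' Z : Type*} [NormedAddCommGroup E''] [NormedSpace ℝ E''] [TopologicalSpace H'']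
  {K : ModelWithCorners ℝ E'' H''} [TopologicalSpace Z] [ChartedSpace H'' Z]

/-- The chain rule, up to the identification of tangent spaces at equal points. -/
theorem mfderiv_chain {f : X → Y} {g : Y → Z} {k : X → Z} {x : X} {y : Y} {z : Z}
    (hf : MDifferentiableAt I J f x) (hg : MDifferentiableAt J K g y) (hy : f x = y)
    (hz : g y = z) (hz' : k x = z) (hk : g ∘ f =ᶠ[𝓝 x] k) (v : TangentSpace I x) :
    tangentCongr K hz (mfderiv J K g y (tangentCongr J hy (mfderiv I J f x v))) =
      tangentCongr K hz' (mfderiv I K k x v) := by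
  subst hy
  subst hz
  have h1 : mfderiv I K (g ∘ f) x v = mfderiv J K g (f x) (mfderiv I J f x v) := by
    rw [mfderiv_comp x hg hf]; rfl
  have h2 := hk.mfderiv_eq (I := I) (I' := K)
  have h3 := tangentCongr_eq K hz' (mfderiv I K k x v)
  rw [tangentCongr_rfl, tangentCongr_rfl]
  refine h1.symm.trans (Eq.trans ?_ h3.symm)
  exact DFunLike.congr_fun h2 v

theorem tangentCongr_mfderiv {f g : X → Y} {x : X} {y : Y} (h : f = g) (hf : f x = y)
    (hg : g x = y) (v : TangentSpace I x) :
    tangentCongr J hf (mfderiv I J f x v) = tangentCongr J hg (mfderiv I J g x v) := by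
  subst h; rfl

end TangentCongr

/-- A smooth principal `G`-bundle `P → M`, with right action `act`. -/
structure PrincipalBundle {EM HM EP HP EG HG : Type*}
    [NormedAddCommGroup EM] [NormedSpace ℝ EM] [TopologicalSpace HM]
    [NormedAddCommGroup EP] [NormedSpace ℝ EP] [TopologicalSpace HP]
    [NormedAddCommGroup EG] [NormedSpace ℝ EG] [TopologicalSpace HG]
    (IM : ModelWithCorners ℝ EM HM) (IP : ModelWithCorners ℝ EP HP)
    (IG : ModelWithCorners ℝ EG HG)
    (M P G : Type*) [TopologicalSpace M] [ChartedSpace HM M]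
    [TopologicalSpace P] [ChartedSpace HP P]
    [TopologicalSpace G] [ChartedSpace HG G] [Group G] where
  proj : P → M
  act : P → G → P
  contMDiff_proj : ContMDiff IP IM ∞ proj
  contMDiff_act : ContMDiff (IP.prod IG) IP ∞ (fun x : P × G => act x.1 x.2)
  act_one : ∀ p, act p 1 = p
  act_mul : ∀ p g h, act p (g * h) = act (act p g) h
  act_free : ∀ p g, act p g = p → g = 1
  /-- The fibres of the projection are exactly the orbits. -/
  proj_eq_iff : ∀ p q, proj p = proj q ↔ ∃ g, act p g = q
  /-- Local triviality, through smooth equivariant trivializations. -/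
  exists_triv : ∀ x : M, ∃ t : Trivialization G proj, x ∈ t.baseSet ∧
    ContMDiffOn IP (IM.prod IG) ∞ t t.source ∧
    ContMDiffOn (IM.prod IG) IP ∞ t.toOpenPartialHomeomorph.symm t.target ∧
    ∀ p ∈ t.source, ∀ g, (t (act p g)).2 = (t p).2 * g

namespace PrincipalBundle

variable {EM HM EP HP EG HG : Type*}
  [NormedAddCommGroup EM] [NormedSpace ℝ EM] [TopologicalSpace HM]
  [NormedAddCommGroup EP] [NormedSpace ℝ EP] [TopologicalSpace HP]
  [NormedAddCommGroup EG] [NormedSpace ℝ EG] [TopologicalSpace HG]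
  {IM : ModelWithCorners ℝ EM HM} {IP : ModelWithCorners ℝ EP HP}
  {IG : ModelWithCorners ℝ EG HG}
  {M P G : Type*} [TopologicalSpace M] [ChartedSpace HM M]
  [TopologicalSpace P] [ChartedSpace HP P]
  [TopologicalSpace G] [ChartedSpace HG G] [Group G]
  (B : PrincipalBundle IM IP IG M P G)

/-- The smooth equivariant local trivializations of a principal bundle. -/
structure LocalTriv extends Trivialization G B.proj where
  contMDiffOn_toFun : ContMDiffOn IP (IM.prod IG) ∞ toOpenPartialHomeomorph source
  contMDiffOn_invFun : ContMDiffOn (IM.prod IG) IP ∞ toOpenPartialHomeomorph.symm target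
  equivariant : ∀ p ∈ source, ∀ g,
    (toOpenPartialHomeomorph (B.act p g)).2 = (toOpenPartialHomeomorph p).2 * g

theorem exists_localTriv (x : M) : ∃ t : B.LocalTriv, x ∈ t.baseSet := by
  obtain ⟨t, h, h1, h2, h3⟩ := B.exists_triv x
  exact ⟨⟨t, h1, h2, h3⟩, h⟩

theorem proj_act (p : P) (g : G) : B.proj (B.act p g) = B.proj p :=
  ((B.proj_eq_iff p _).2 ⟨g, rfl⟩).symm

theorem proj_surjective : Function.Surjective B.proj := by
  intro x
  obtain ⟨t, h⟩ := B.exists_localTriv x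
  exact ⟨t.toOpenPartialHomeomorph.symm (x, 1), t.toTrivialization.proj_symm_apply' h⟩

theorem mdifferentiable_proj : MDifferentiable IP IM B.proj :=
  B.contMDiff_proj.mdifferentiable (by simp)

theorem contMDiff_act_right (g : G) : ContMDiff IP IP ∞ (fun p => B.act p g) :=
  B.contMDiff_act.comp (contMDiff_id.prodMk contMDiff_const)

theorem mdifferentiable_act_right (g : G) : MDifferentiable IP IP (fun p => B.act p g) :=
  (B.contMDiff_act_right g).mdifferentiable (by simp)

theorem mdifferentiable_act_left (p : P) : MDifferentiable IG IP (B.act p) :=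
  (B.contMDiff_act.comp (contMDiff_const.prodMk contMDiff_id)).mdifferentiable (by simp)

/-- The infinitesimal action `ξ ↦ d/dt|₀ p · exp (t ξ)`, that is, the derivative at the identity
of the orbit map `g ↦ p · g`. -/
def infAct (p : P) : GroupLieAlgebra IG G →L[ℝ] TangentSpace IP p :=
  (tangentCongr IP (B.act_one p)).toContinuousLinearMap.comp (mfderiv IG IP (B.act p) 1)

/-- The vertical subspace `V_p P`. -/
def vertical (p : P) : Submodule ℝ (TangentSpace IP p) :=
  LinearMap.ker (mfderiv IP IM B.proj p).toLinearMap

variable {B}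

namespace LocalTriv

variable (t : B.LocalTriv)

/-- The group component of a local trivialization. -/
def fib (p : P) : G := (t.toOpenPartialHomeomorph p).2

/-- The local inverse of a local trivialization. -/
def inv (x : M) (g : G) : P := t.toOpenPartialHomeomorph.symm (x, g)

theorem mem_source {p : P} : p ∈ t.source ↔ B.proj p ∈ t.baseSet := t.toTrivialization.mem_source

theorem inv_fib {p : P} (hp : B.proj p ∈ t.baseSet) : t.inv (B.proj p) (t.fib p) = p :=
  t.toTrivialization.symm_apply_mk_proj (t.mem_source.2 hp)

theorem proj_inv {x : M} (hx : x ∈ t.baseSet) (g : G) : B.proj (t.inv x g) = x :=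
  t.toTrivialization.proj_symm_apply' hx

theorem fib_inv {x : M} (hx : x ∈ t.baseSet) (g : G) : t.fib (t.inv x g) = g := by
  have := t.toTrivialization.apply_symm_apply' (x := g) hx
  exact congrArg Prod.snd this

theorem fib_act {p : P} (hp : B.proj p ∈ t.baseSet) (g : G) :
    t.fib (B.act p g) = t.fib p * g := t.equivariant p (t.mem_source.2 hp) g

theorem nhds_base {p : P} (hp : B.proj p ∈ t.baseSet) : ∀ᶠ q in 𝓝 p, B.proj q ∈ t.baseSet :=
  B.contMDiff_proj.continuous.continuousAt (t.open_baseSet.mem_nhds hp)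

theorem contMDiffAt_fib {p : P} (hp : B.proj p ∈ t.baseSet) : ContMDiffAt IP IG ∞ t.fib p :=
  (t.contMDiffOn_toFun.contMDiffAt (t.open_source.mem_nhds (t.mem_source.2 hp))).snd

theorem contMDiffAt_inv {x : M} (hx : x ∈ t.baseSet) (g : G) :
    ContMDiffAt (IM.prod IG) IP ∞ (fun z : M × G => t.inv z.1 z.2) (x, g) :=
  t.contMDiffOn_invFun.contMDiffAt (t.open_target.mem_nhds (t.toTrivialization.mem_target.2 hx))

variable [LieGroup IG ∞ G]

/-- The flat local connection form of a local trivialization: the pullback of the left-invariant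
Maurer-Cartan form by the group component. -/
def flatForm (p : P) : TangentSpace IP p →L[ℝ] GroupLieAlgebra IG G :=
  (tangentCongr IG (inv_mul_cancel (t.fib p))).toContinuousLinearMap.comp
    (mfderiv IP IG (fun q => (t.fib p)⁻¹ * t.fib q) p)

open Classical in
/-- The flat local horizontal lift of a local trivialization: the derivative at `proj p` of the
local section which is constant in the trivialization and passes through `p`. -/
def flatLift (p : P) : TangentSpace IM (B.proj p) →L[ℝ] TangentSpace IP p :=
  if hp : B.proj p ∈ t.baseSet then
    (tangentCongr IP (t.inv_fib hp)).toContinuousLinearMap.comp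
      (mfderiv IM IP (fun x => t.inv x (t.fib p)) (B.proj p))
  else 0

theorem flatLift_apply {p : P} (hp : B.proj p ∈ t.baseSet) (v : TangentSpace IM (B.proj p)) :
    t.flatLift p v = tangentCongr IP (t.inv_fib hp)
      (mfderiv IM IP (fun x => t.inv x (t.fib p)) (B.proj p) v) := by
  simp only [flatLift, dif_pos hp]; rfl

theorem flatForm_apply {p : P} (v : TangentSpace IP p) :
    t.flatForm p v = tangentCongr IG (inv_mul_cancel (t.fib p))
      (mfderiv IP IG (fun q => (t.fib p)⁻¹ * t.fib q) p v) := rfl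

theorem contMDiffAt_flat {p : P} (hp : B.proj p ∈ t.baseSet) (g : G) :
    ContMDiffAt IP IG ∞ (fun q => g⁻¹ * t.fib q) p :=
  (contMDiffAt_const (c := g⁻¹)).mul (t.contMDiffAt_fib hp)

theorem contMDiffAt_inv_left {x : M} (hx : x ∈ t.baseSet) (g : G) :
    ContMDiffAt IM IP ∞ (fun y => t.inv y g) x :=
  (t.contMDiffAt_inv hx g).comp x (contMDiffAt_id.prodMk contMDiffAt_const)

theorem proj_flatLift {p : P} (hp : B.proj p ∈ t.baseSet) (v : TangentSpace IM (B.proj p)) :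
    mfderiv IP IM B.proj p (t.flatLift p v) = v := by
  rw [flatLift_apply t hp]
  have := mfderiv_chain (I := IM) (J := IP) (K := IM) (k := id) (z := B.proj p)
    ((t.contMDiffAt_inv_left hp (t.fib p)).mdifferentiableAt (by simp))
    (B.mdifferentiable_proj p) (t.inv_fib hp) rfl rfl
    (by filter_upwards [t.open_baseSet.mem_nhds hp] with y hy using t.proj_inv hy _) v
  rw [mfderiv_id] at this
  exact this

theorem flatForm_flatLift {p : P} (hp : B.proj p ∈ t.baseSet) (v : TangentSpace IM (B.proj p)) :
    t.flatForm p (t.flatLift p v) = 0 := by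
  rw [flatLift_apply t hp, flatForm_apply]
  rw [mfderiv_chain (I := IM) (J := IP) (K := IG) (k := fun _ => (1 : G)) (z := (1 : G))
    ((t.contMDiffAt_inv_left hp (t.fib p)).mdifferentiableAt (by simp))
    ((t.contMDiffAt_flat hp (t.fib p)).mdifferentiableAt (by simp)) (t.inv_fib hp)
    (inv_mul_cancel _) rfl
    (by filter_upwards [t.open_baseSet.mem_nhds hp] with y hy
        simp [t.fib_inv hy]) v, mfderiv_const]
  rfl

theorem flatForm_infAct {p : P} (hp : B.proj p ∈ t.baseSet) (ξ : GroupLieAlgebra IG G) :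
    t.flatForm p (B.infAct p ξ) = ξ := by
  rw [flatForm_apply]
  have := mfderiv_chain (I := IG) (J := IP) (K := IG) (k := id) (z := (1 : G))
    (B.mdifferentiable_act_left p 1)
    ((t.contMDiffAt_flat hp (t.fib p)).mdifferentiableAt (by simp)) (B.act_one p)
    (inv_mul_cancel _) rfl
    (by filter_upwards with g; simp [t.fib_act hp]) ξ
  rw [mfderiv_id] at this
  exact this

end LocalTriv

variable (B) in
theorem proj_infAct (p : P) (ξ : GroupLieAlgebra IG G) :
    mfderiv IP IM B.proj p (B.infAct p ξ) = 0 := by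
  have := mfderiv_chain (I := IG) (J := IP) (K := IM) (k := fun _ => B.proj p) (z := B.proj p)
    (B.mdifferentiable_act_left p 1)
    (B.mdifferentiable_proj p) (B.act_one p) rfl rfl
    (by filter_upwards with g using B.proj_act p g) ξ
  rw [mfderiv_const] at this
  exact this

namespace LocalTriv
variable (t : B.LocalTriv) [LieGroup IG ∞ G]

theorem decomp {p : P} (hp : B.proj p ∈ t.baseSet) (X : TangentSpace IP p) :
    t.flatLift p (mfderiv IP IM B.proj p X) + B.infAct p (t.flatForm p X) = X := by
  let F : M × G → P := fun z => t.inv z.1 (t.fib p * z.2)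
  let f : P → M × G := fun q => (B.proj q, (t.fib p)⁻¹ * t.fib q)
  have hF : MDifferentiableAt (IM.prod IG) IP F (B.proj p, 1) := by
    have h : ContMDiffAt (IM.prod IG) IP ∞ F (B.proj p, 1) :=
      (t.contMDiffAt_inv hp (t.fib p * 1)).comp (B.proj p, (1 : G))
        (f := fun z : M × G => (z.1, t.fib p * z.2))
        (contMDiffAt_fst.prodMk (contMDiffAt_const.mul contMDiffAt_snd))
    exact h.mdifferentiableAt (by simp)
  have hf1 := B.mdifferentiable_proj p
  have hf2 := (t.contMDiffAt_flat hp (t.fib p)).mdifferentiableAt (n := ∞) (by simp)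
  have hf : MDifferentiableAt IP (IM.prod IG) f p := hf1.prodMk hf2
  have hy : f p = (B.proj p, 1) := by simp [f]
  have hz : F (B.proj p, 1) = p := by simp [F, t.inv_fib hp]
  have key := mfderiv_chain (k := id) hf hF hy hz rfl
    (by filter_upwards [t.nhds_base hp] with q hq; simp [F, f, t.inv_fib hq]) X
  rw [mfderiv_id] at key
  have key' : tangentCongr IP hz (mfderiv (IM.prod IG) IP F (B.proj p, 1)
    (tangentCongr (IM.prod IG) hy (mfderiv IP (IM.prod IG) f p X))) = X := key
  set w := tangentCongr (IM.prod IG) hy (mfderiv IP (IM.prod IG) f p X) with hw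
  have hwE := tangentCongr_eq (IM.prod IG) hy (mfderiv IP (IM.prod IG) f p X)
  have hfd := DFunLike.congr_fun (mfderiv_prodMk hf1 hf2) X
  have h1 : w.1 = mfderiv IP IM B.proj p X := congrArg Prod.fst (hwE.trans hfd)
  have h2 : w.2 = t.flatForm p X :=
    (congrArg Prod.snd (hwE.trans hfd)).trans (tangentCongr_eq IG (inv_mul_cancel (t.fib p))
      (mfderiv IP IG (fun q => (t.fib p)⁻¹ * t.fib q) p X)).symm
  have h3 : tangentCongr IP hz (mfderiv IM IP (fun z => F (z, 1)) (B.proj p)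
      (mfderiv IP IM B.proj p X)) = t.flatLift p (mfderiv IP IM B.proj p X) := by
    rw [flatLift_apply t hp]
    have hfun : (fun z => F (z, 1)) = fun x => t.inv x (t.fib p) := by
      funext z; simp only [F, mul_one]
    exact tangentCongr_mfderiv hfun hz (t.inv_fib hp) _
  have h4 : tangentCongr IP hz (mfderiv IG IP (fun z => F (B.proj p, z)) 1
      (t.flatForm p X)) = B.infAct p (t.flatForm p X) := by
    have hfun : (fun z => F (B.proj p, z)) = B.act p := by
      funext k
      have := t.inv_fib (p := B.act p k) (by rwa [B.proj_act])
      rwa [B.proj_act, t.fib_act hp] at this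
    exact tangentCongr_mfderiv hfun hz (B.act_one p) _
  have h5 := mfderiv_prod_eq_add_apply (v := w) hF
  rw [← h3, ← h4, ← h1, ← h2, ← map_add]
  refine Eq.trans ?_ key'
  exact congrArg (tangentCongr IP hz) h5.symm

end LocalTriv

section Vertical

variable [LieGroup IG ∞ G] (B)

theorem infAct_mem_vertical (p : P) (ξ : GroupLieAlgebra IG G) :
    B.infAct p ξ ∈ B.vertical p := B.proj_infAct p ξ

theorem exists_vertEquiv (p : P) : ∃ e : GroupLieAlgebra IG G ≃L[ℝ] B.vertical p,
    ∀ ξ, (e ξ : TangentSpace IP p) = B.infAct p ξ := by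
  obtain ⟨t, ht⟩ := B.exists_localTriv (B.proj p)
  refine ⟨ContinuousLinearEquiv.equivOfInverse
    ((B.infAct p).codRestrict (B.vertical p) (B.infAct_mem_vertical p))
    ((t.flatForm p).comp (B.vertical p).subtypeL) (fun ξ => t.flatForm_infAct ht ξ)
    (fun X => Subtype.ext ?_), fun ξ => rfl⟩
  have h := t.decomp ht X
  have hX : mfderiv IP IM B.proj p X = 0 := X.2
  rw [hX, map_zero, zero_add] at h
  exact h

/-- The identification `𝔤 ≃ V_p P`, `ξ ↦ d/dt|₀ p · exp (t ξ)`. -/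
def vertEquiv (p : P) : GroupLieAlgebra IG G ≃L[ℝ] B.vertical p :=
  (B.exists_vertEquiv p).choose

theorem vertEquiv_apply (p : P) (ξ : GroupLieAlgebra IG G) :
    (B.vertEquiv p ξ : TangentSpace IP p) = B.infAct p ξ :=
  (B.exists_vertEquiv p).choose_spec ξ

end Vertical

section Jets

variable (B)

/-- The fibre over `p` of the first jet bundle: the right inverses of the derivative of the
projection. -/
def JetFiber (p : P) : Type _ :=
  {ρ : TangentSpace IM (B.proj p) →L[ℝ] TangentSpace IP p //
    ∀ v, mfderiv IP IM B.proj p (ρ v) = v}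

instance (p : P) : TopologicalSpace (B.JetFiber p) := instTopologicalSpaceSubtype

/-- The first jet bundle `J¹P`, as a set; `TotalSpace.proj` is the projection `τ₁₀`. -/
abbrev J1 : Type _ := TotalSpace (EM →L[ℝ] EG) B.JetFiber

/-- The projection `τ₁₀ : J¹P → P`. -/
abbrev tau10 (ρ : B.J1) : P := ρ.proj

variable [LieGroup IG ∞ G]

instance (p : P) : Nonempty (B.JetFiber p) := by
  obtain ⟨t, ht⟩ := B.exists_localTriv (B.proj p)
  exact ⟨⟨t.flatLift p, t.proj_flatLift ht⟩⟩

variable [IsManifold IM ∞ M] [IsManifold IP ∞ P]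
variable {B}

/-- The coordinate of a jet `ρ` at `p`, in a local trivialization of `P` and the chart of `M` at
`x₀`. -/
def jetCoord (t : B.LocalTriv) (x₀ : M) {p : P} (ρ : B.JetFiber p) : EM →L[ℝ] EG :=
  ((t.flatForm p).comp ρ.1).comp
    ((trivializationAt EM (TangentSpace IM) x₀).symmL ℝ (B.proj p))

/-- The domain of `jetCoord`. -/
def jetDom (t : B.LocalTriv) (x₀ : M) : Set P :=
  B.proj ⁻¹' (t.baseSet ∩ (trivializationAt EM (TangentSpace IM) x₀).baseSet)

/-- The jet at `p` with a given coordinate. -/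
def jetOfCoord (t : B.LocalTriv) (x₀ : M) {p : P} (hp : p ∈ jetDom t x₀)
    (A : EM →L[ℝ] EG) : B.JetFiber p :=
  ⟨t.flatLift p + (B.infAct p).comp (A.comp
    ((trivializationAt EM (TangentSpace IM) x₀).continuousLinearMapAt ℝ (B.proj p))), by
    intro v
    refine (map_add (mfderiv IP IM B.proj p) _ _).trans ?_
    exact (congrArg₂ (· + ·) (t.proj_flatLift hp.1 v) (B.proj_infAct p _)).trans (add_zero v)⟩

theorem jetOfCoord_jetCoord (t : B.LocalTriv) (x₀ : M) {p : P} (hp : p ∈ jetDom t x₀)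
    (ρ : B.JetFiber p) : jetOfCoord t x₀ hp (jetCoord t x₀ ρ) = ρ := by
  refine Subtype.ext (ContinuousLinearMap.ext fun v => ?_)
  have h := t.decomp hp.1 (ρ.1 v)
  rw [ρ.2 v] at h
  have h2 : (trivializationAt EM (TangentSpace IM) x₀).symmL ℝ (B.proj p)
    ((trivializationAt EM (TangentSpace IM) x₀).continuousLinearMapAt ℝ (B.proj p) v) = v :=
    Trivialization.symmL_continuousLinearMapAt _ hp.2 v
  refine Eq.trans ?_ h
  exact congrArg (fun w => t.flatLift p v + B.infAct p (t.flatForm p (ρ.1 w))) h2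

theorem jetCoord_jetOfCoord (t : B.LocalTriv) (x₀ : M) {p : P} (hp : p ∈ jetDom t x₀)
    (A : EM →L[ℝ] EG) : jetCoord t x₀ (jetOfCoord t x₀ hp A) = A := by
  refine ContinuousLinearMap.ext fun v => ?_
  have h2 : (trivializationAt EM (TangentSpace IM) x₀).continuousLinearMapAt ℝ (B.proj p)
    ((trivializationAt EM (TangentSpace IM) x₀).symmL ℝ (B.proj p) v) = v :=
    Trivialization.continuousLinearMapAt_symmL _ hp.2 v
  refine (map_add (t.flatForm p) _ _).trans ?_
  refine (congrArg₂ (· + ·) (t.flatForm_flatLift hp.1 _) (t.flatForm_infAct hp.1 _)).trans ?_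
  exact (zero_add _).trans (congrArg A h2)

theorem isOpen_jetDom (t : B.LocalTriv) (x₀ : M) : IsOpen (jetDom t x₀) :=
  (t.open_baseSet.inter (trivializationAt EM (TangentSpace IM) x₀).open_baseSet).preimage
    B.contMDiff_proj.continuous

open Classical in
/-- The local trivialization of `J¹P → P` given by `jetCoord`. -/
def jetPretriv (t : B.LocalTriv) (x₀ : M) :
    Pretrivialization (EM →L[ℝ] EG) (π (EM →L[ℝ] EG) B.JetFiber) where
  toFun ρ := (ρ.1, jetCoord t x₀ ρ.2)
  invFun z := if hz : z.1 ∈ jetDom t x₀ then ⟨z.1, jetOfCoord t x₀ hz z.2⟩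
    else ⟨z.1, Classical.arbitrary _⟩
  source := π (EM →L[ℝ] EG) B.JetFiber ⁻¹' jetDom t x₀
  target := jetDom t x₀ ×ˢ univ
  map_source' ρ hρ := ⟨hρ, mem_univ _⟩
  map_target' z hz := by
    simp only [dif_pos hz.1]; exact hz.1
  left_inv' := by
    rintro ⟨p, ρ⟩ (hρ : p ∈ jetDom t x₀)
    simp only [dif_pos hρ, jetOfCoord_jetCoord]
  right_inv' := by
    rintro ⟨p, A⟩ hz
    have hp : p ∈ jetDom t x₀ := hz.1
    dsimp only
    rw [dif_pos hp, jetCoord_jetOfCoord]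
  open_target := (isOpen_jetDom t x₀).prod isOpen_univ
  baseSet := jetDom t x₀
  open_baseSet := isOpen_jetDom t x₀
  source_eq := rfl
  target_eq := rfl
  proj_toFun _ _ := rfl

theorem coordChangeL_eq (x₀ x₀' : M) {x : M}
    (h : x ∈ (trivializationAt EM (TangentSpace IM) x₀).baseSet)
    (h' : x ∈ (trivializationAt EM (TangentSpace IM) x₀').baseSet) (v : EM) :
    (trivializationAt EM (TangentSpace IM) x₀).coordChangeL ℝ
          (trivializationAt EM (TangentSpace IM) x₀') x v =
      (trivializationAt EM (TangentSpace IM) x₀').continuousLinearMapAt ℝ x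
        ((trivializationAt EM (TangentSpace IM) x₀).symmL ℝ x v) := by
  rw [Trivialization.coordChangeL_apply _ _ ⟨h, h'⟩,
    Trivialization.continuousLinearMapAt_apply, Trivialization.coe_linearMapAt_of_mem _ h',
    Trivialization.symmL_apply _ h]

/-- The affine change of coordinates between two local trivializations of `J¹P → P`. -/
def jetShift (t t' : B.LocalTriv) (x₀ : M) (p : P) : EM →L[ℝ] EG :=
  ((t.flatForm p).comp (t'.flatLift p)).comp
    ((trivializationAt EM (TangentSpace IM) x₀).symmL ℝ (B.proj p))

theorem jetPretriv_change (t t' : B.LocalTriv) (x₀ x₀' : M) {z : P × (EM →L[ℝ] EG)}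
    (hz : z.1 ∈ jetDom t x₀) (hz' : z.1 ∈ jetDom t' x₀') :
    jetPretriv t x₀ ((jetPretriv t' x₀').toPartialEquiv.symm z) =
      (z.1, jetShift t t' x₀ z.1 + z.2.comp
        ((trivializationAt EM (TangentSpace IM) x₀).coordChangeL ℝ
          (trivializationAt EM (TangentSpace IM) x₀') (B.proj z.1) : EM →L[ℝ] EM)) := by
  have h1 : (jetPretriv t' x₀').toPartialEquiv.symm z = ⟨z.1, jetOfCoord t' x₀' hz' z.2⟩ :=
    dif_pos hz'
  rw [h1]
  refine Prod.ext rfl (ContinuousLinearMap.ext fun v => ?_)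
  refine (map_add (t.flatForm z.1) _ _).trans ?_
  refine congrArg₂ (· + ·) rfl ((t.flatForm_infAct hz.1 _).trans (congrArg z.2 ?_))
  exact (coordChangeL_eq x₀ x₀' hz.2 hz'.2 v).symm

theorem continuousLinearMapAt_self {g : G} (hg : g = 1) (v : TangentSpace IG g) :
    (trivializationAt EG (TangentSpace IG) (1 : G)).continuousLinearMapAt ℝ g v =
      tangentCongr IG hg v := by
  subst hg
  rw [TangentBundle.continuousLinearMapAt_trivializationAt_eq_core (mem_chart_source HG _)]
  exact (tangentBundleCore IG G).coordChange_self (achart HG 1) 1 (mem_chart_source HG _) v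

theorem contMDiffAt_jetShift (t t' : B.LocalTriv) (x₀ : M) {p : P}
    (hp : p ∈ jetDom t x₀) (hp' : B.proj p ∈ t'.baseSet) :
    ContMDiffAt IP 𝓘(ℝ, EM →L[ℝ] EG) ∞ (jetShift t t' x₀) p := by
  let f : P → M → G := fun q y => (t.fib q)⁻¹ * t.fib (t'.inv y (t'.fib q))
  have hinv : ContMDiffAt (IP.prod IM) IP ∞ (fun z : P × M => t'.inv z.2 (t'.fib z.1))
      (p, B.proj p) :=
    (t'.contMDiffAt_inv hp' (t'.fib p)).comp (p, B.proj p)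
      (f := fun z : P × M => (z.2, t'.fib z.1))
      (contMDiffAt_snd.prodMk (ContMDiffAt.comp (p, B.proj p) (g := t'.fib) (f := Prod.fst)
        (t'.contMDiffAt_fib hp') contMDiffAt_fst))
  have hf : ContMDiffAt (IP.prod IM) IG ∞ (Function.uncurry f) (p, B.proj p) := by
    refine ContMDiffAt.mul (ContMDiffAt.inv ?_) ?_
    · exact ContMDiffAt.comp (p, B.proj p) (g := t.fib) (f := Prod.fst)
        (t.contMDiffAt_fib hp.1) contMDiffAt_fst
    · refine ContMDiffAt.comp (p, B.proj p) (g := t.fib) ?_ hinv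
      rw [t'.inv_fib hp']
      exact t.contMDiffAt_fib hp.1
  have h1 := ContMDiffAt.mfderiv (m := ∞) f B.proj hf B.contMDiff_proj.contMDiffAt (by simp)
  have h2 : ContMDiffAt IP 𝓘(ℝ, EM →L[ℝ] EM) ∞ (fun q =>
      ((trivializationAt EM (TangentSpace IM) x₀).coordChangeL ℝ
        (trivializationAt EM (TangentSpace IM) (B.proj p)) (B.proj q) : EM →L[ℝ] EM)) p :=
    ContMDiffAt.coordChangeL B.contMDiff_proj.contMDiffAt hp.2
      (mem_baseSet_trivializationAt EM (TangentSpace IM) (B.proj p))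
  refine (h1.clm_comp h2).congr_of_eventuallyEq ?_
  have hone : ∀ q, B.proj q ∈ t'.baseSet → f q (B.proj q) = 1 := by
    intro q hq; simp [f, t'.inv_fib hq]
  filter_upwards [(isOpen_jetDom t x₀).mem_nhds hp, t'.nhds_base hp',
    B.contMDiff_proj.continuous.continuousAt
      ((trivializationAt EM (TangentSpace IM) (B.proj p)).open_baseSet.mem_nhds
        (mem_baseSet_trivializationAt EM (TangentSpace IM) (B.proj p)))] with q hq hq' hqp
  refine ContinuousLinearMap.ext fun v => ?_
  set w : TangentSpace IM (B.proj q) :=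
    (trivializationAt EM (TangentSpace IM) x₀).symmL ℝ (B.proj q) v with hw
  have e1 : t.flatForm q (t'.flatLift q w) =
      tangentCongr IG (hone q hq') (mfderiv IM IG (f q) (B.proj q) w) := by
    rw [t'.flatLift_apply hq', t.flatForm_apply]
    exact mfderiv_chain ((t'.contMDiffAt_inv_left hq' _).mdifferentiableAt (by simp))
      ((t.contMDiffAt_flat hq.1 (t.fib q)).mdifferentiableAt (by simp)) (t'.inv_fib hq')
      (inv_mul_cancel _) (hone q hq') (by rfl) w
  have e2 : (trivializationAt EM (TangentSpace IM) (B.proj p)).symmL ℝ (B.proj q)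
      ((trivializationAt EM (TangentSpace IM) x₀).coordChangeL ℝ
        (trivializationAt EM (TangentSpace IM) (B.proj p)) (B.proj q) v) = w := by
    rw [coordChangeL_eq x₀ (B.proj p) hq.2 hqp]
    exact Trivialization.symmL_continuousLinearMapAt _ hqp w
  have e3 : (trivializationAt EG (TangentSpace IG) (f p (B.proj p))).continuousLinearMapAt ℝ
      (f q (B.proj q)) (mfderiv IM IG (f q) (B.proj q) w) = t.flatForm q (t'.flatLift q w) := by
    rw [e1, hone p hp']
    exact continuousLinearMapAt_self (hone q hq') _
  refine Eq.trans (Eq.symm e3) ?_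
  exact congrArg (fun u => (trivializationAt EG (TangentSpace IG)
    (f p (B.proj p))).continuousLinearMapAt ℝ
      (f q (B.proj q)) (mfderiv IM IG (f q) (B.proj q) u)) e2.symm

theorem contMDiffOn_jetPretriv_change (t t' : B.LocalTriv) (x₀ x₀' : M) :
    ContMDiffOn (IP.prod 𝓘(ℝ, EM →L[ℝ] EG)) (IP.prod 𝓘(ℝ, EM →L[ℝ] EG)) ∞
      (jetPretriv t x₀ ∘ (jetPretriv t' x₀').toPartialEquiv.symm)
      ((jetDom t' x₀' ∩ jetDom t x₀) ×ˢ univ) := by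
  have h : ContMDiffOn (IP.prod 𝓘(ℝ, EM →L[ℝ] EG)) (IP.prod 𝓘(ℝ, EM →L[ℝ] EG)) ∞
      (fun z : P × (EM →L[ℝ] EG) => (z.1, jetShift t t' x₀ z.1 + z.2.comp
        ((trivializationAt EM (TangentSpace IM) x₀).coordChangeL ℝ
          (trivializationAt EM (TangentSpace IM) x₀') (B.proj z.1) : EM →L[ℝ] EM)))
      ((jetDom t' x₀' ∩ jetDom t x₀) ×ˢ univ) := by
    rintro ⟨p, A⟩ ⟨⟨hp', hp⟩, -⟩
    refine ContMDiffAt.contMDiffWithinAt ?_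
    refine contMDiffAt_fst.prodMk (ContMDiffAt.add ?_ (ContMDiffAt.clm_comp contMDiffAt_snd ?_))
    · exact ContMDiffAt.comp (p, A) (g := jetShift t t' x₀) (f := Prod.fst)
        (contMDiffAt_jetShift t t' x₀ hp hp'.1) contMDiffAt_fst
    · exact ContMDiffAt.coordChangeL (f := fun z : P × (EM →L[ℝ] EG) => B.proj z.1)
        (B.contMDiff_proj.contMDiffAt.comp (p, A) contMDiffAt_fst) hp.2 hp'.2
  exact h.congr fun z hz => jetPretriv_change t t' x₀ x₀' hz.1.2 hz.1.1

theorem jetPretriv_change_dom (t t' : B.LocalTriv) (x₀ x₀' : M) :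
    (jetPretriv t' x₀').target ∩
      (jetPretriv t' x₀').toPartialEquiv.symm ⁻¹' (jetPretriv t x₀).source =
      (jetDom t' x₀' ∩ jetDom t x₀) ×ˢ univ := by
  ext ⟨p, A⟩
  constructor
  · rintro ⟨h1, h2⟩
    have hp : p ∈ jetDom t' x₀' := h1.1
    refine ⟨⟨hp, ?_⟩, mem_univ _⟩
    have h3 : (jetPretriv t' x₀').toPartialEquiv.symm (p, A) = ⟨p, jetOfCoord t' x₀' hp A⟩ :=
      dif_pos hp
    rw [mem_preimage, h3] at h2
    exact h2
  · rintro ⟨⟨hp, hp'⟩, -⟩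
    refine ⟨⟨hp, mem_univ _⟩, ?_⟩
    have h3 : (jetPretriv t' x₀').toPartialEquiv.symm (p, A) = ⟨p, jetOfCoord t' x₀' hp A⟩ :=
      dif_pos hp
    rw [mem_preimage, h3]
    exact hp'

theorem isInducing_jetPretriv (t : B.LocalTriv) (x₀ : M) {p : P} (hp : p ∈ jetDom t x₀) :
    Topology.IsInducing (jetPretriv t x₀ ∘ TotalSpace.mk p) := by
  let e := trivializationAt EM (TangentSpace IM) x₀
  have h1 : Continuous (fun ρ : B.JetFiber p => jetCoord t x₀ ρ) := by
    have c1 := (ContinuousLinearMap.postcomp (𝕜₁ := ℝ) (σ := RingHom.id ℝ)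
      (TangentSpace IM (B.proj p)) (t.flatForm p)).continuous
    have c2 := (ContinuousLinearMap.precomp (𝕜₂ := ℝ) (τ := RingHom.id ℝ)
      (GroupLieAlgebra IG G) (e.symmL ℝ (B.proj p))).continuous
    exact c2.comp (c1.comp continuous_subtype_val)
  refine Topology.IsInducing.of_comp (g := fun z : P × (EM →L[ℝ] EG) =>
    t.flatLift p + (B.infAct p).comp (z.2.comp (e.continuousLinearMapAt ℝ (B.proj p))))
     (continuous_const.prodMk h1) ?_ ?_
  · have c1 := (ContinuousLinearMap.postcomp (𝕜₁ := ℝ) (σ := RingHom.id ℝ)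
      (TangentSpace IM (B.proj p)) (B.infAct p)).continuous
    have c2 := (ContinuousLinearMap.precomp (𝕜₂ := ℝ) (τ := RingHom.id ℝ)
      EG (e.continuousLinearMapAt ℝ (B.proj p))).continuous
    exact continuous_const.add (c1.comp (c2.comp continuous_snd))
  · have : ((fun z : P × (EM →L[ℝ] EG) => t.flatLift p +
        (B.infAct p).comp (z.2.comp (e.continuousLinearMapAt ℝ (B.proj p)))) ∘
        (jetPretriv t x₀ ∘ TotalSpace.mk p)) = Subtype.val := by
      funext ρ
      exact congrArg Subtype.val (jetOfCoord_jetCoord t x₀ hp ρ)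
    rw [this]
    exact Topology.IsInducing.subtypeVal

variable (B)

/-- A local trivialization around a given point. -/
def trivAt (x : M) : B.LocalTriv := (B.exists_localTriv x).choose

theorem mem_trivAt (x : M) : x ∈ (B.trivAt x).baseSet := (B.exists_localTriv x).choose_spec

theorem mem_jetDom (p : P) : p ∈ jetDom (B.trivAt (B.proj p)) (B.proj p) :=
  ⟨B.mem_trivAt _, mem_baseSet_trivializationAt EM (TangentSpace IM) (B.proj p)⟩

/-- The bundle structure of `J¹P → P`. Its trivializations `jetPretriv` give `J¹P` its topology and
its smooth structure, the standard one: the charts are the fibred coordinates of a local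
trivialization of `P` and a chart of `M`. -/
def jetPrebundle : FiberPrebundle (EM →L[ℝ] EG) B.JetFiber where
  pretrivializationAtlas := range fun i : B.LocalTriv × M => jetPretriv i.1 i.2
  pretrivializationAt p := jetPretriv (B.trivAt (B.proj p)) (B.proj p)
  mem_base_pretrivializationAt p := B.mem_jetDom p
  pretrivialization_mem_atlas p := ⟨(B.trivAt (B.proj p), B.proj p), rfl⟩
  continuous_trivChange := by
    rintro _ ⟨⟨t, x₀⟩, rfl⟩ _ ⟨⟨t', x₀'⟩, rfl⟩
    rw [jetPretriv_change_dom]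
    exact (contMDiffOn_jetPretriv_change t t' x₀ x₀').continuousOn
  totalSpaceMk_isInducing p := isInducing_jetPretriv _ _ (B.mem_jetDom p)

instance : TopologicalSpace B.J1 := B.jetPrebundle.totalSpaceTopology

instance : FiberBundle (EM →L[ℝ] EG) B.JetFiber := B.jetPrebundle.toFiberBundle

/-- The groupoid of the local diffeomorphisms of a manifold. -/
def smoothGroupoid {E H : Type*} [NormedAddCommGroup E] [NormedSpace ℝ E] [TopologicalSpace H]
    (I : ModelWithCorners ℝ E H) (X : Type*) [TopologicalSpace X] [ChartedSpace H X] :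
    StructureGroupoid X :=
  Pregroupoid.groupoid
    { property := fun f s => ContMDiffOn I I ∞ f s
      comp := fun {f g u v} hf hg _ _ _ =>
        hg.comp (hf.mono inter_subset_left) (fun x hx => hx.2)
      id_mem := contMDiffOn_id
      locality := fun {f u} _ h x hx => by
        obtain ⟨v, hv, hxv, h⟩ := h x hx
        exact (h x ⟨hx, hxv⟩).mono_of_mem_nhdsWithin
          (inter_mem_nhdsWithin _ (hv.mem_nhds hxv))
      congr := fun {f g u} _ h hf => hf.congr h }

/-- `J¹P` is a smooth manifold. -/
instance : IsManifold (IP.prod 𝓘(ℝ, EM →L[ℝ] EG)) ∞ B.J1 := by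
  have key : ∀ e ∈ trivializationAtlas (EM →L[ℝ] EG) B.JetFiber,
      ∀ e' ∈ trivializationAtlas (EM →L[ℝ] EG) B.JetFiber,
      ContMDiffOn (IP.prod 𝓘(ℝ, EM →L[ℝ] EG)) (IP.prod 𝓘(ℝ, EM →L[ℝ] EG)) ∞
        (e.toOpenPartialHomeomorph.symm ≫ₕ e'.toOpenPartialHomeomorph)
        (e.toOpenPartialHomeomorph.symm ≫ₕ e'.toOpenPartialHomeomorph).source := by
    rintro _ ⟨_, ⟨⟨t, x₀⟩, rfl⟩, rfl⟩ _ ⟨_, ⟨⟨t', x₀'⟩, rfl⟩, rfl⟩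
    refine (contMDiffOn_jetPretriv_change t' t x₀' x₀).mono ?_
    rw [← jetPretriv_change_dom]
    exact subset_rfl
  have : HasGroupoid B.J1 (smoothGroupoid (IP.prod 𝓘(ℝ, EM →L[ℝ] EG)) (P × (EM →L[ℝ] EG))) := by
    constructor
    rintro _ _ ⟨e, he, rfl⟩ ⟨e', he', rfl⟩
    refine mem_groupoid_of_pregroupoid.2 ⟨key e he e' he', ?_⟩
    exact key e' he' e he
  refine { StructureGroupoid.HasGroupoid.comp
    (smoothGroupoid (IP.prod 𝓘(ℝ, EM →L[ℝ] EG)) (P × (EM →L[ℝ] EG))) ?_ with }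
  intro e he
  rw [isLocalStructomorphOn_contDiffGroupoid_iff]
  exact mem_groupoid_of_pregroupoid.1 he

end Jets

section ConnectionBundle

variable (B)

/-- The right action of `G` on `J¹P` lifted from `P`: `ρ · g = T_p R_g ∘ ρ`. -/
def jetAct (ρ : B.J1) (g : G) : B.J1 :=
  ⟨B.act ρ.proj g,
    ⟨((mfderiv IP IP (fun q => B.act q g) ρ.proj).comp ρ.snd.1).comp
      (tangentCongr IM (B.proj_act ρ.proj g)).toContinuousLinearMap, by
    intro v
    have h := mfderiv_chain (k := B.proj) (z := B.proj ρ.proj)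
      (B.mdifferentiable_act_right g ρ.proj) (B.mdifferentiable_proj _) rfl
      (B.proj_act ρ.proj g) rfl (by filter_upwards with q using B.proj_act q g)
      (ρ.snd.1 (tangentCongr IM (B.proj_act ρ.proj g) v))
    rw [ρ.snd.2] at h
    exact (tangentCongr IM (B.proj_act ρ.proj g)).injective h⟩⟩

theorem jet_ext {ρ ρ' : B.J1} (h : ρ.proj = ρ'.proj)
    (h' : ∀ v, tangentCongr IP h (ρ.snd.1 v) =
      ρ'.snd.1 (tangentCongr IM (congrArg B.proj h) v)) : ρ = ρ' := by
  obtain ⟨p, ρ⟩ := ρ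
  obtain ⟨p', ρ'⟩ := ρ'
  obtain rfl : p = p' := h
  exact congrArg (TotalSpace.mk p) (Subtype.ext (ContinuousLinearMap.ext h'))

theorem jetAct_one (ρ : B.J1) : B.jetAct ρ 1 = ρ := by
  refine B.jet_ext (B.act_one _) fun v => ?_
  have h := tangentCongr_mfderiv (I := IP) (J := IP) (x := ρ.proj) (y := ρ.proj)
    (f := fun q => B.act q 1) (g := id) (funext B.act_one) (B.act_one _) rfl
    (ρ.snd.1 (tangentCongr IM (B.proj_act ρ.proj 1) v))
  rw [mfderiv_id] at h
  exact h

theorem jetAct_mul (ρ : B.J1) (g h : G) : B.jetAct ρ (g * h) = B.jetAct (B.jetAct ρ g) h := by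
  refine B.jet_ext (B.act_mul _ _ _) fun v => ?_
  have e := mfderiv_chain (I := IP) (J := IP) (K := IP) (x := ρ.proj)
    (k := fun q => B.act q (g * h)) (B.mdifferentiable_act_right g ρ.proj)
    (B.mdifferentiable_act_right h _) rfl rfl (B.act_mul _ _ _)
    (by filter_upwards with q using (B.act_mul q g h).symm)
    (ρ.snd.1 (tangentCongr IM (B.proj_act ρ.proj (g * h)) v))
  refine e.symm.trans ?_
  have e2 : tangentCongr IM (B.proj_act ρ.proj (g * h)) v =
      tangentCongr IM (B.proj_act ρ.proj g) (tangentCongr IM (B.proj_act (B.act ρ.proj g) h)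
        (tangentCongr IM (congrArg B.proj (B.act_mul ρ.proj g h)) v)) := by
    refine ((tangentCongr_trans IM _ _ _).trans ?_).symm
    exact tangentCongr_trans IM _ _ _
  exact congrArg (fun w => mfderiv IP IP (fun q => B.act q h) (B.act ρ.proj g)
    (mfderiv IP IP (fun q => B.act q g) ρ.proj (ρ.snd.1 w))) e2

/-- The orbit equivalence relation of `G` on `J¹P`. -/
def jetSetoid : Setoid B.J1 where
  r ρ ρ' := ∃ g, B.jetAct ρ g = ρ'
  iseqv :=
    { refl := fun ρ => ⟨1, B.jetAct_one ρ⟩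
      symm := by
        rintro ρ _ ⟨g, rfl⟩
        exact ⟨g⁻¹, by rw [← B.jetAct_mul, mul_inv_cancel, B.jetAct_one]⟩
      trans := by
        rintro ρ _ _ ⟨g, rfl⟩ ⟨h, rfl⟩
        exact ⟨g * h, B.jetAct_mul ρ g h⟩ }

/-- The bundle of connections `C(P) = J¹P / G`. -/
def ConnBundle : Type _ := Quotient B.jetSetoid

/-- The class `[ρ]_G`. -/
def toConn (ρ : B.J1) : B.ConnBundle := Quotient.mk B.jetSetoid ρ

/-- The projection `p : C(P) → M`. -/
def connProj : B.ConnBundle → M :=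
  Quotient.lift (fun ρ : B.J1 => B.proj ρ.proj) (by
    rintro ρ _ ⟨g, rfl⟩
    exact (B.proj_act ρ.proj g).symm)

/-- The pullback bundle `p^*P ⊆ C(P) × P`. -/
def ConnPullback : Type _ := {x : B.ConnBundle × P // B.connProj x.1 = B.proj x.2}

/-- The map `J¹P → p^*P`, `ρ ↦ ([ρ]_G, τ₁₀ ρ)`. -/
def toConnPullback (ρ : B.J1) : B.ConnPullback := ⟨(B.toConn ρ, B.tau10 ρ), rfl⟩

theorem toConnPullback_bijective : Function.Bijective B.toConnPullback := by
  constructor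
  · intro ρ ρ' h
    have h1 : B.toConn ρ = B.toConn ρ' := congrArg (fun x => x.1.1) h
    have h2 : ρ.proj = ρ'.proj := congrArg (fun x => x.1.2) h
    obtain ⟨g, rfl⟩ := Quotient.exact h1
    have hg : g = 1 := B.act_free ρ.proj g h2.symm
    rw [hg, B.jetAct_one]
  · rintro ⟨⟨c, u⟩, h⟩
    obtain ⟨ρ, rfl⟩ := Quotient.exists_rep c
    obtain ⟨g, hg⟩ := (B.proj_eq_iff ρ.proj u).1 h
    refine ⟨B.jetAct ρ g, Subtype.ext (Prod.ext ?_ hg)⟩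
    exact (Quotient.sound (s := B.jetSetoid) ⟨g, rfl⟩).symm

/-- The identification `J¹P ≃ p^*P`. -/
def jetEquivPullback : B.J1 ≃ B.ConnPullback :=
  Equiv.ofBijective B.toConnPullback B.toConnPullback_bijective

variable {B}

/-- The projection `id - ρ ∘ T τ : T_p P → V_p P` determined by a jet `ρ` at `p`. -/
def jetProj (ρ : B.J1) : TangentSpace IP ρ.proj →L[ℝ] TangentSpace IP ρ.proj :=
  ContinuousLinearMap.id ℝ _ - ρ.snd.1.comp (mfderiv IP IM B.proj ρ.proj)

theorem jetProj_mem (ρ : B.J1) (X : TangentSpace IP ρ.proj) :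
    jetProj ρ X ∈ B.vertical ρ.proj := by
  change mfderiv IP IM B.proj ρ.proj (X - ρ.snd.1 (mfderiv IP IM B.proj ρ.proj X)) = 0
  rw [map_sub, ρ.snd.2, sub_self]

end ConnectionBundle

section Connections

variable (B)

/-- A principal connection: a smooth `G`-equivariant family of projections
`Γ_p : T_p P → V_p P` onto the vertical subspaces. -/
structure Connection [IsManifold IP ∞ P] where
  toFun : ∀ p : P, TangentSpace IP p →L[ℝ] TangentSpace IP p
  mem_vertical : ∀ p X, toFun p X ∈ B.vertical p
  apply_vertical : ∀ p, ∀ X ∈ B.vertical p, toFun p X = X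
  equivariant : ∀ p g X, toFun (B.act p g) (mfderiv IP IP (fun q => B.act q g) p X) =
    mfderiv IP IP (fun q => B.act q g) p (toFun p X)
  contMDiff_toFun : ContMDiff IP (IP.prod 𝓘(ℝ, EP →L[ℝ] EP)) ∞
    (fun p => TotalSpace.mk' (EP →L[ℝ] EP)
      (E := fun p : P => TangentSpace IP p →L[ℝ] TangentSpace IP p) p (toFun p))

variable {B} [LieGroup IG ∞ G] [IsManifold IP ∞ P]

namespace Connection

variable (Γ : B.Connection)

/-- The connection form `ω_Γ ∈ Ω¹(P, 𝔤)`. -/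
def form (p : P) : TangentSpace IP p →L[ℝ] GroupLieAlgebra IG G :=
  (B.vertEquiv p).symm.toContinuousLinearMap.comp
    ((Γ.toFun p).codRestrict (B.vertical p) (Γ.mem_vertical p))

theorem exists_jet (p : P) : ∃ ρ : B.JetFiber p, jetProj (B := B) ⟨p, ρ⟩ = Γ.toFun p := by
  obtain ⟨t, ht⟩ := B.exists_localTriv (B.proj p)
  have hΓ : ∀ X, mfderiv IP IM B.proj p (Γ.toFun p X) = 0 := Γ.mem_vertical p
  refine ⟨⟨t.flatLift p - (Γ.toFun p).comp (t.flatLift p), fun v => ?_⟩,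
    ContinuousLinearMap.ext fun (X : TangentSpace IP p) => ?_⟩
  · change mfderiv IP IM B.proj p (t.flatLift p v - Γ.toFun p (t.flatLift p v)) = v
    rw [map_sub, t.proj_flatLift ht, hΓ, sub_zero]
  · have h1 : Γ.toFun p (X - t.flatLift p (mfderiv IP IM B.proj p X)) =
        X - t.flatLift p (mfderiv IP IM B.proj p X) := by
      refine Γ.apply_vertical p _ ?_
      change mfderiv IP IM B.proj p (X - t.flatLift p (mfderiv IP IM B.proj p X)) = 0
      rw [map_sub, t.proj_flatLift ht, sub_self]
    rw [map_sub] at h1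
    change X - (t.flatLift p (mfderiv IP IM B.proj p X) -
      Γ.toFun p (t.flatLift p (mfderiv IP IM B.proj p X))) = Γ.toFun p X
    rw [sub_eq_iff_eq_add] at h1
    rw [h1]
    abel

/-- The section `σ_Γ : M → C(P)`: `σ_Γ(m) = [ρ]_G` for a jet `ρ` over `m` whose vertical
projection is the one of `Γ`. -/
def sigma (m : M) : B.ConnBundle :=
  let p : P := (B.proj_surjective m).choose
  B.toConn ⟨p, (Γ.exists_jet p).choose⟩

theorem connProj_sigma (m : M) : B.connProj (Γ.sigma m) = m := (B.proj_surjective m).choose_spec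

/-- The section `σ̃_Γ : P → J¹P`, `u ↦ (σ_Γ(τ u), u)` under the identification `J¹P ≃ p^*P`. -/
def sigmaTilde (u : P) : B.J1 :=
  B.jetEquivPullback.symm ⟨(Γ.sigma (B.proj u), u), Γ.connProj_sigma (B.proj u)⟩

end Connection

variable [IsManifold IM ∞ M]
variable (B) in
/-- The canonical form `ω ∈ Ω¹(J¹P, 𝔤)`: `ω_ρ(Y)` is the element of `𝔤` that corresponds to the
vertical vector `(id - ρ ∘ T τ)(T τ₁₀ Y)`. -/
def canonicalForm (ρ : B.J1) :
    TangentSpace (IP.prod 𝓘(ℝ, EM →L[ℝ] EG)) ρ →L[ℝ] GroupLieAlgebra IG G :=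
  ((B.vertEquiv ρ.proj).symm.toContinuousLinearMap.comp
    ((jetProj ρ).codRestrict (B.vertical ρ.proj) (jetProj_mem ρ))).comp
      (mfderiv (IP.prod 𝓘(ℝ, EM →L[ℝ] EG)) IP B.tau10 ρ)

end Connections

end PrincipalBundle

/-- The pullback of a `V`-valued 1-form. -/
def pullbackForm {E H X E' H' Y V : Type*} [NormedAddCommGroup E] [NormedSpace ℝ E]
    [TopologicalSpace H] (I : ModelWithCorners ℝ E H) [TopologicalSpace X] [ChartedSpace H X]
    [NormedAddCommGroup E'] [NormedSpace ℝ E'] [TopologicalSpace H']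
    (J : ModelWithCorners ℝ E' H') [TopologicalSpace Y] [ChartedSpace H' Y]
    [AddCommGroup V] [Module ℝ V] [TopologicalSpace V]
    (f : X → Y) (α : ∀ y : Y, TangentSpace J y →L[ℝ] V) (x : X) : TangentSpace I x →L[ℝ] V :=
  (α (f x)).comp (mfderiv I J f x)

end

/-!
A jet `ρ` at `p` is determined by its vertical projection `id - ρ ∘ T τ`, since `T τ ∘ ρ = id`.
Hence a connection `Γ` singles out one jet `Γ.jet p` at every point `p`, equivariance of `Γ` says
that `p ↦ Γ.jet p` commutes with the action of `G`, and so the orbit `σ_Γ(τ u)` is the class of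
`Γ.jet u`; in other words `σ̃_Γ(u) = Γ.jet u`. Locally `Γ.jet = (id - Γ) ∘ L` for the smooth
horizontal lift `L` of a local trivialization, which gives smoothness. Finally
`T τ₁₀ ∘ T σ̃_Γ = id`, so `σ̃_Γ^* ω` at `u` is the vertical projection of the jet `Γ.jet u`, which
is `Γ_u`.
-/

section TangentHom

variable {EN HN N : Type*} [NormedAddCommGroup EN] [NormedSpace ℝ EN] [TopologicalSpace HN]
  {J : ModelWithCorners ℝ EN HN} [TopologicalSpace N] [ChartedSpace HN N]
  {E₁ H₁ M₁ : Type*} [NormedAddCommGroup E₁] [NormedSpace ℝ E₁] [TopologicalSpace H₁]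
  {I₁ : ModelWithCorners ℝ E₁ H₁} [TopologicalSpace M₁] [ChartedSpace H₁ M₁] [IsManifold I₁ 1 M₁]
  {E₂ H₂ M₂ : Type*} [NormedAddCommGroup E₂] [NormedSpace ℝ E₂] [TopologicalSpace H₂]
  {I₂ : ModelWithCorners ℝ E₂ H₂} [TopologicalSpace M₂] [ChartedSpace H₂ M₂] [IsManifold I₂ 1 M₂]
  {E₃ H₃ M₃ : Type*} [NormedAddCommGroup E₃] [NormedSpace ℝ E₃] [TopologicalSpace H₃]
  {I₃ : ModelWithCorners ℝ E₃ H₃} [TopologicalSpace M₃] [ChartedSpace H₃ M₃] [IsManifold I₃ 1 M₃]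
  {n m : WithTop ℕ∞} {x₀ : N}

theorem continuousLinearMapAt_tangentCongr (b : M₁) {x y : M₁} (h : x = y)
    (v : TangentSpace I₁ x) :
    (trivializationAt E₁ (TangentSpace I₁) b).continuousLinearMapAt ℝ y (tangentCongr I₁ h v) =
      (trivializationAt E₁ (TangentSpace I₁) b).continuousLinearMapAt ℝ x v := by
  subst h
  rfl

variable (J I₁ I₂) in
/-- A family of linear maps `φ x : T_{f x} M₁ → T_{g x} M₂`, parametrized by a manifold `N`, is
`C^n` at `x₀`: its matrix in the trivializations of the tangent bundles at `f x₀` and `g x₀` is.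
This is smoothness of a section of `Hom(f^* TM₁, g^* TM₂)`, stated without pullback bundles. -/
def ContMDiffTangentHomAt (n : WithTop ℕ∞) (f : N → M₁) (g : N → M₂)
    (φ : ∀ x, TangentSpace I₁ (f x) →L[ℝ] TangentSpace I₂ (g x)) (x₀ : N) : Prop :=
  ContMDiffAt J 𝓘(ℝ, E₁ →L[ℝ] E₂) n (fun x => ContinuousLinearMap.inCoordinates
    E₁ (TangentSpace I₁) E₂ (TangentSpace I₂) (f x₀) (f x) (g x₀) (g x) (φ x)) x₀

namespace ContMDiffTangentHomAt

theorem congr_of_eventually {f : N → M₁} {g : N → M₂}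
    {φ ψ : ∀ x, TangentSpace I₁ (f x) →L[ℝ] TangentSpace I₂ (g x)}
    (hφ : ContMDiffTangentHomAt J I₁ I₂ n f g φ x₀) (h : ∀ᶠ x in 𝓝 x₀, ψ x = φ x) :
    ContMDiffTangentHomAt J I₁ I₂ n f g ψ x₀ :=
  ContMDiffAt.congr_of_eventuallyEq hφ (h.mono fun _ hx => by simp only [hx])

theorem sub {f : N → M₁} {g : N → M₂}
    {φ ψ : ∀ x, TangentSpace I₁ (f x) →L[ℝ] TangentSpace I₂ (g x)}
    (hφ : ContMDiffTangentHomAt J I₁ I₂ n f g φ x₀)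
    (hψ : ContMDiffTangentHomAt J I₁ I₂ n f g ψ x₀) :
    ContMDiffTangentHomAt J I₁ I₂ n f g (fun x => φ x - ψ x) x₀ := by
  refine (ContMDiffAt.sub hφ hψ).congr_of_eventuallyEq (Eventually.of_forall fun x => ?_)
  simp only [ContinuousLinearMap.inCoordinates, ContinuousLinearMap.sub_comp,
    ContinuousLinearMap.comp_sub]

theorem comp {f : N → M₁} {g : N → M₂} {h : N → M₃}
    {ψ : ∀ x, TangentSpace I₂ (g x) →L[ℝ] TangentSpace I₃ (h x)}
    {φ : ∀ x, TangentSpace I₁ (f x) →L[ℝ] TangentSpace I₂ (g x)}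
    (hψ : ContMDiffTangentHomAt J I₂ I₃ n g h ψ x₀)
    (hφ : ContMDiffTangentHomAt J I₁ I₂ n f g φ x₀) (hg : ContinuousAt g x₀) :
    ContMDiffTangentHomAt J I₁ I₃ n f h (fun x => (ψ x).comp (φ x)) x₀ := by
  have hbase : ∀ᶠ x in 𝓝 x₀, g x ∈ (trivializationAt E₂ (TangentSpace I₂) (g x₀)).baseSet :=
    hg ((Trivialization.open_baseSet _).mem_nhds (mem_baseSet_trivializationAt _ _ _))
  refine (ContMDiffAt.clm_comp hψ hφ).congr_of_eventuallyEq ?_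
  filter_upwards [hbase] with x hx
  ext v
  simp only [ContinuousLinearMap.inCoordinates, ContinuousLinearMap.comp_apply,
    Trivialization.symmL_continuousLinearMapAt _ hx]

theorem comp_parameter {E' H' N' : Type*} [NormedAddCommGroup E'] [NormedSpace ℝ E']
    [TopologicalSpace H'] {J' : ModelWithCorners ℝ E' H'} [TopologicalSpace N']
    [ChartedSpace H' N'] {f : N → M₁} {g : N → M₂}
    {φ : ∀ x, TangentSpace I₁ (f x) →L[ℝ] TangentSpace I₂ (g x)} {k : N' → N} {y₀ : N'}
    (hφ : ContMDiffTangentHomAt J I₁ I₂ n f g φ (k y₀)) (hk : ContMDiffAt J' J n k y₀) :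
    ContMDiffTangentHomAt J' I₁ I₂ n (f ∘ k) (g ∘ k) (fun y => φ (k y)) y₀ :=
  ContMDiffAt.comp y₀ hφ hk

theorem of_eq_mfderiv [IsManifold J 1 N] {F : N → M₁ → M₂} {f : N → M₁} {g : N → M₂}
    {φ : ∀ x, TangentSpace I₁ (f x) →L[ℝ] TangentSpace I₂ (g x)}
    (hF : ContMDiffAt (J.prod I₁) I₂ n (Function.uncurry F) (x₀, f x₀))
    (hf : ContMDiffAt J I₁ m f x₀) (hmn : m + 1 ≤ n)
    (hφ : ∀ᶠ x in 𝓝 x₀, ∃ h : F x (f x) = g x,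
      ∀ v, φ x v = tangentCongr I₂ h (mfderiv I₁ I₂ (F x) (f x) v)) :
    ContMDiffTangentHomAt J I₁ I₂ m f g φ x₀ := by
  refine (ContMDiffAt.mfderiv F f hF hf hmn).congr_of_eventuallyEq ?_
  obtain ⟨h₀, -⟩ := hφ.self_of_nhds
  filter_upwards [hφ] with x ⟨hx, hφx⟩
  ext v
  simp only [inTangentCoordinates, ContinuousLinearMap.inCoordinates,
    ContinuousLinearMap.comp_apply, hφx, h₀, continuousLinearMapAt_tangentCongr]

end ContMDiffTangentHomAt

end TangentHom

namespace PrincipalBundle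

variable {EM HM EP HP EG HG : Type*}
  [NormedAddCommGroup EM] [NormedSpace ℝ EM] [TopologicalSpace HM]
  [NormedAddCommGroup EP] [NormedSpace ℝ EP] [TopologicalSpace HP]
  [NormedAddCommGroup EG] [NormedSpace ℝ EG] [TopologicalSpace HG]
  {IM : ModelWithCorners ℝ EM HM} {IP : ModelWithCorners ℝ EP HP}
  {IG : ModelWithCorners ℝ EG HG}
  {M P G : Type*} [TopologicalSpace M] [ChartedSpace HM M]
  [TopologicalSpace P] [ChartedSpace HP P]
  [TopologicalSpace G] [ChartedSpace HG G] [Group G]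
  {B : PrincipalBundle IM IP IG M P G}

section RightTranslation

variable (B)

/-- The right translation `R_g : p ↦ p · g` as a diffeomorphism, used to see that `T_p R_g` is
surjective. -/
def rightTranslation (g : G) : P ≃ₘ⟮IP, IP⟯ P where
  toFun p := B.act p g
  invFun p := B.act p g⁻¹
  left_inv p := by simp only [← B.act_mul, mul_inv_cancel, B.act_one]
  right_inv p := by simp only [← B.act_mul, inv_mul_cancel, B.act_one]
  contMDiff_toFun := B.contMDiff_act_right g
  contMDiff_invFun := B.contMDiff_act_right g⁻¹

theorem mfderiv_act_surjective (p : P) (g : G) :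
    Function.Surjective (mfderiv IP IP (fun q => B.act q g) p) :=
  ((B.rightTranslation g).mfderivToContinuousLinearEquiv (by simp) p).surjective

theorem mfderiv_proj_mfderiv_act (p : P) (g : G) (X : TangentSpace IP p) :
    tangentCongr IM (B.proj_act p g) (mfderiv IP IM B.proj (B.act p g)
      (mfderiv IP IP (fun q => B.act q g) p X)) = mfderiv IP IM B.proj p X :=
  mfderiv_chain (k := B.proj) (z := B.proj p) (B.mdifferentiable_act_right g p)
    (B.mdifferentiable_proj _) rfl (B.proj_act p g) rfl
    (Eventually.of_forall fun q => B.proj_act q g) X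

end RightTranslation

section JetProjection

theorem jetFiber_eq_of_jetProj_eq {p : P} {ρ ρ' : B.JetFiber p}
    (h : jetProj (B := B) ⟨p, ρ⟩ = jetProj (B := B) ⟨p, ρ'⟩) : ρ = ρ' := by
  refine Subtype.ext (ContinuousLinearMap.ext fun v => ?_)
  have hv : ρ.1 v - ρ.1 (mfderiv IP IM B.proj p (ρ.1 v)) =
      ρ.1 v - ρ'.1 (mfderiv IP IM B.proj p (ρ.1 v)) := DFunLike.congr_fun h (ρ.1 v)
  rw [ρ.2] at hv
  exact sub_right_injective hv

theorem jetProj_jetAct (ρ : B.J1) (g : G) (X : TangentSpace IP ρ.proj) :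
    jetProj (B.jetAct ρ g) (mfderiv IP IP (fun q => B.act q g) ρ.proj X) =
      mfderiv IP IP (fun q => B.act q g) ρ.proj (jetProj ρ X) := by
  let T := mfderiv IP IP (fun q => B.act q g) ρ.proj
  have hjet : jetProj (B.jetAct ρ g) (T X) =
      T X - T (ρ.snd.1 (mfderiv IP IM B.proj ρ.proj X)) :=
    congrArg (fun w => T X - T (ρ.snd.1 w)) (B.mfderiv_proj_mfderiv_act ρ.proj g X)
  exact hjet.trans (map_sub T _ _).symm

end JetProjection

section SmoothJets

variable [LieGroup IG ∞ G]

theorem jetCoord_eq_inCoordinates [IsManifold IM ∞ M] (t : B.LocalTriv) (x₀ : M) {p : P}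
    (ρ : B.JetFiber p) :
    jetCoord t x₀ ρ = ContinuousLinearMap.inCoordinates EM (TangentSpace IM) EG (TangentSpace IG)
      x₀ (B.proj p) (1 : G) (1 : G) ((t.flatForm p).comp ρ.1) :=
  ContinuousLinearMap.ext fun _ => (continuousLinearMapAt_self rfl _).symm

variable [IsManifold IP ∞ P]

theorem LocalTriv.contMDiffTangentHomAt_flatForm (t : B.LocalTriv) {p : P}
    (hp : B.proj p ∈ t.baseSet) :
    ContMDiffTangentHomAt IP IP IG ∞ id (fun _ => (1 : G)) t.flatForm p := by
  have hfib := t.contMDiffAt_fib hp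
  refine .of_eq_mfderiv (F := fun q r => (t.fib q)⁻¹ * t.fib r) (n := ∞) ?_ contMDiffAt_id
    (by simp) (Eventually.of_forall fun q => ⟨inv_mul_cancel _, fun _ => t.flatForm_apply _⟩)
  exact (ContMDiffAt.comp (p, p) (g := t.fib) (f := Prod.fst) hfib contMDiffAt_fst).inv.mul
    (ContMDiffAt.comp (p, p) (g := t.fib) (f := Prod.snd) hfib contMDiffAt_snd)

variable [IsManifold IM ∞ M]

theorem LocalTriv.contMDiffTangentHomAt_flatLift (t : B.LocalTriv) {p : P}
    (hp : B.proj p ∈ t.baseSet) :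
    ContMDiffTangentHomAt IP IM IP ∞ B.proj id t.flatLift p := by
  refine .of_eq_mfderiv (F := fun q x => t.inv x (t.fib q)) (n := ∞) ?_
    B.contMDiff_proj.contMDiffAt (by simp)
    ((t.nhds_base hp).mono fun q hq => ⟨t.inv_fib hq, t.flatLift_apply hq⟩)
  exact (t.contMDiffAt_inv hp (t.fib p)).comp (p, B.proj p) (f := fun z : P × M => (z.2, t.fib z.1))
    (contMDiffAt_snd.prodMk (ContMDiffAt.comp (p, B.proj p) (g := t.fib) (f := Prod.fst)
      (t.contMDiffAt_fib hp) contMDiffAt_fst))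

theorem contMDiffAt_J1_of_contMDiffTangentHomAt {EN HN N : Type*} [NormedAddCommGroup EN]
    [NormedSpace ℝ EN] [TopologicalSpace HN] {J : ModelWithCorners ℝ EN HN} [TopologicalSpace N]
    [ChartedSpace HN N] {s : N → B.J1} {x : N}
    (hbase : ContMDiffAt J IP ∞ (fun y => B.tau10 (s y)) x)
    (hlift : ContMDiffTangentHomAt J IM IP ∞ (fun y => B.proj (B.tau10 (s y)))
      (fun y => B.tau10 (s y)) (fun y => (s y).snd.1) x) :
    ContMDiffAt J (IP.prod 𝓘(ℝ, EM →L[ℝ] EG)) ∞ s x := by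
  let t := B.trivAt (B.proj (s x).proj)
  have hform := (t.contMDiffTangentHomAt_flatForm (B.mem_trivAt _)).comp_parameter
    (k := fun y => B.tau10 (s y)) hbase
  have hcoord : ContMDiffAt J 𝓘(ℝ, EM →L[ℝ] EG) ∞
      (fun y => jetCoord t (B.proj (s x).proj) (s y).snd) x := by
    simp only [jetCoord_eq_inCoordinates]
    exact hform.comp hlift hbase.continuousAt
  exact contMDiffAt_totalSpace.2 ⟨hbase, hcoord⟩

end SmoothJets

section CanonicalForm

variable [LieGroup IG ∞ G] [IsManifold IP ∞ P] [IsManifold IM ∞ M]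

theorem vertEquiv_canonicalForm (ρ : B.J1)
    (Y : TangentSpace (IP.prod 𝓘(ℝ, EM →L[ℝ] EG)) ρ) :
    (B.vertEquiv ρ.proj (B.canonicalForm ρ Y) : TangentSpace IP ρ.proj) =
      jetProj ρ (mfderiv (IP.prod 𝓘(ℝ, EM →L[ℝ] EG)) IP B.tau10 ρ Y) :=
  congrArg Subtype.val ((B.vertEquiv ρ.proj).apply_symm_apply _)

theorem mfderiv_tau10_mfderiv_section {ρ : ∀ q, B.JetFiber q} {p : P}
    (hρ : MDifferentiableAt IP (IP.prod 𝓘(ℝ, EM →L[ℝ] EG)) (fun q => (⟨q, ρ q⟩ : B.J1)) p)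
    (X : TangentSpace IP p) :
    mfderiv (IP.prod 𝓘(ℝ, EM →L[ℝ] EG)) IP B.tau10 ⟨p, ρ p⟩
      (mfderiv IP (IP.prod 𝓘(ℝ, EM →L[ℝ] EG)) (fun q => (⟨q, ρ q⟩ : B.J1)) p X) = X := by
  have htau : MDifferentiable (IP.prod 𝓘(ℝ, EM →L[ℝ] EG)) IP B.tau10 :=
    (Bundle.contMDiff_proj (IB := IP) (n := ∞) B.JetFiber).mdifferentiable (by simp)
  have hchain := mfderiv_chain (g := B.tau10) (k := id) (z := p) hρ (htau _) rfl rfl rfl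
    EventuallyEq.rfl X
  rw [mfderiv_id] at hchain
  exact hchain

theorem vertEquiv_pullbackForm_canonicalForm {ρ : ∀ q, B.JetFiber q} {p : P}
    (hρ : MDifferentiableAt IP (IP.prod 𝓘(ℝ, EM →L[ℝ] EG)) (fun q => (⟨q, ρ q⟩ : B.J1)) p)
    (X : TangentSpace IP p) :
    (B.vertEquiv p (pullbackForm IP (IP.prod 𝓘(ℝ, EM →L[ℝ] EG)) (fun q => (⟨q, ρ q⟩ : B.J1))
      B.canonicalForm p X) : TangentSpace IP p) = jetProj (B := B) ⟨p, ρ p⟩ X :=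
  (vertEquiv_canonicalForm ⟨p, ρ p⟩ _).trans
    (congrArg (jetProj (B := B) ⟨p, ρ p⟩) (mfderiv_tau10_mfderiv_section hρ X))

end CanonicalForm

namespace Connection

variable [IsManifold IP ∞ P] (Γ : B.Connection)

theorem contMDiffTangentHomAt_toFun (p : P) :
    ContMDiffTangentHomAt IP IP IP ∞ id id Γ.toFun p :=
  ((contMDiffAt_hom_bundle _).1 (Γ.contMDiff_toFun p)).2

variable [LieGroup IG ∞ G]

/-- The horizontal lift of `Γ` at `p`: the unique jet `ρ` at `p` with `id - ρ ∘ T τ = Γ_p`. The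
choice is the one made in `sigma`. -/
noncomputable def jet (p : P) : B.JetFiber p := (Γ.exists_jet p).choose

theorem jetProj_jet (p : P) : jetProj (B := B) ⟨p, Γ.jet p⟩ = Γ.toFun p :=
  (Γ.exists_jet p).choose_spec

theorem jetAct_jet (p : P) (g : G) :
    B.jetAct ⟨p, Γ.jet p⟩ g = ⟨B.act p g, Γ.jet (B.act p g)⟩ := by
  refine congrArg (TotalSpace.mk (B.act p g)) (jetFiber_eq_of_jetProj_eq ?_)
  refine ContinuousLinearMap.ext fun (Y : TangentSpace IP (B.act p g)) => ?_
  obtain ⟨X, rfl⟩ := B.mfderiv_act_surjective p g Y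
  let T := mfderiv IP IP (fun q => B.act q g) p
  have hleft : jetProj (B.jetAct ⟨p, Γ.jet p⟩ g) (T X) = T (Γ.toFun p X) :=
    (jetProj_jetAct ⟨p, Γ.jet p⟩ g X).trans
      (congrArg T (DFunLike.congr_fun (Γ.jetProj_jet p) X))
  have hright : jetProj (B := B) ⟨B.act p g, Γ.jet (B.act p g)⟩ (T X) = T (Γ.toFun p X) :=
    (DFunLike.congr_fun (Γ.jetProj_jet (B.act p g)) (T X)).trans (Γ.equivariant p g X)
  exact hleft.trans hright.symm

theorem sigma_proj (u : P) : Γ.sigma (B.proj u) = B.toConn ⟨u, Γ.jet u⟩ := by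
  obtain ⟨g, hg⟩ := (B.proj_eq_iff _ u).1 (B.proj_surjective (B.proj u)).choose_spec
  refine Quotient.sound (s := B.jetSetoid) ⟨g, (Γ.jetAct_jet _ g).trans ?_⟩
  rw [hg]

theorem sigmaTilde_eq_jet : Γ.sigmaTilde = fun u => ⟨u, Γ.jet u⟩ :=
  funext fun u => (Equiv.symm_apply_eq _).2 (Subtype.ext (Prod.ext (Γ.sigma_proj u) rfl))

theorem jet_eq_flatLift_sub (t : B.LocalTriv) {p : P} (hp : B.proj p ∈ t.baseSet) :
    (Γ.jet p).1 = t.flatLift p - (Γ.toFun p).comp (t.flatLift p) := by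
  refine ContinuousLinearMap.ext fun v => ?_
  have hjet : Γ.toFun p (t.flatLift p v) =
      t.flatLift p v - (Γ.jet p).1 (mfderiv IP IM B.proj p (t.flatLift p v)) := by
    rw [← Γ.jetProj_jet p]
    rfl
  rw [t.proj_flatLift hp] at hjet
  exact eq_sub_of_add_eq' (eq_sub_iff_add_eq.1 hjet)

theorem vertEquiv_form (p : P) (X : TangentSpace IP p) :
    (B.vertEquiv p (Γ.form p X) : TangentSpace IP p) = Γ.toFun p X :=
  congrArg Subtype.val ((B.vertEquiv p).apply_symm_apply _)

variable [IsManifold IM ∞ M]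

theorem contMDiffTangentHomAt_jet (p : P) :
    ContMDiffTangentHomAt IP IM IP ∞ B.proj id (fun q => (Γ.jet q).1) p := by
  obtain ⟨t, ht⟩ := B.exists_localTriv (B.proj p)
  have hlift := t.contMDiffTangentHomAt_flatLift ht
  have hvert := (Γ.contMDiffTangentHomAt_toFun p).comp hlift continuousAt_id
  exact (hlift.sub hvert).congr_of_eventually
    ((t.nhds_base ht).mono fun _ hq => Γ.jet_eq_flatLift_sub t hq)

theorem contMDiff_jet : ContMDiff IP (IP.prod 𝓘(ℝ, EM →L[ℝ] EG)) ∞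
    (fun u => (⟨u, Γ.jet u⟩ : B.J1)) := fun p =>
  contMDiffAt_J1_of_contMDiffTangentHomAt contMDiffAt_id (Γ.contMDiffTangentHomAt_jet p)

theorem pullbackForm_jet_canonicalForm :
    pullbackForm IP (IP.prod 𝓘(ℝ, EM →L[ℝ] EG)) (fun u => (⟨u, Γ.jet u⟩ : B.J1))
      B.canonicalForm = Γ.form := by
  funext u
  refine ContinuousLinearMap.ext fun X => (B.vertEquiv u).injective (Subtype.ext ?_)
  rw [vertEquiv_pullbackForm_canonicalForm (Γ.contMDiff_jet.mdifferentiable (by simp) u),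
    Γ.jetProj_jet, Γ.vertEquiv_form]

end Connection

end PrincipalBundle

theorem mainTheorem8 {EM HM EP HP EG HG : Type*}
    [NormedAddCommGroup EM] [NormedSpace ℝ EM] [TopologicalSpace HM]
    [NormedAddCommGroup EP] [NormedSpace ℝ EP] [TopologicalSpace HP]
    [NormedAddCommGroup EG] [NormedSpace ℝ EG] [TopologicalSpace HG]
    {IM : ModelWithCorners ℝ EM HM} {IP : ModelWithCorners ℝ EP HP}
    {IG : ModelWithCorners ℝ EG HG}
    {M P G : Type*} [TopologicalSpace M] [ChartedSpace HM M] [IsManifold IM ∞ M]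
    [TopologicalSpace P] [ChartedSpace HP P] [IsManifold IP ∞ P]
    [TopologicalSpace G] [ChartedSpace HG G] [Group G] [LieGroup IG ∞ G]
    (B : PrincipalBundle IM IP IG M P G) (Γ : B.Connection) :
    ContMDiff IP (IP.prod 𝓘(ℝ, EM →L[ℝ] EG)) ∞ Γ.sigmaTilde ∧
    (∀ u : P, B.tau10 (Γ.sigmaTilde u) = u) ∧
    pullbackForm IP (IP.prod 𝓘(ℝ, EM →L[ℝ] EG)) Γ.sigmaTilde B.canonicalForm = Γ.form := by
  rw [Γ.sigmaTilde_eq_jet]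
  exact ⟨Γ.contMDiff_jet, fun _ => rfl, Γ.pullbackForm_jet_canonicalForm⟩
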